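/- **Setting.** There are concepts $R_0,\dots,R_n$. The words referring to $R_0$ form a probability space; each word $w$ comes with the list $L(w)\subseteq\{R_0,\dots,R_n\}$ of the concepts to which it refers, and $R_0\in L(w)$. Let $p_i$ be the probability that a word also refers to $R_i$, and $p_{i_1\dots i_k}$ the probability that it refers to all of the distinct concepts $R_{i_1},\dots,R_{i_k}$. The overlaps $p_1,\dots,p_n$ are themselves independent random variables with a common probability density $f$ on $[0,1]$, and almost surely the independence hypothesis $p_{i_1\dots i_k}=p_{i_1}\cdots p_{i_k}$ holds for all sets of distinct indices in $\{1,\dots,n\}$. Given the overlaps, the teacher produces independent words $w_1,w_2,\dots$, and the batch learner has learned $R_0$ after $k$ steps if $L(w_1)\cap\dots\cap L(w_k)=\{R_0\}$. For $0<\Delta<1$ let $N_\Delta$ be the least $k$ such that, given the overlaps, this event has probability at least $1-\Delta$; thus $N_\Delta$ is a function of the random overlaps. **Notation.** For $r:\mathbb N\to(0,\infty)$, "$N_\Delta=|\log\Delta|\,\Theta(r(n))$" means: for every $n$, almost surely $N_\Delta<\infty$ for all $\Delta\in(0,1)$; and for all $\Delta_0\in(0,1)$ and $\varepsilon>0$ there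 are $c,C>0$ and $n_0$, depending only on $f,\Delta_0,\varepsilon$, such that for every $n\ge n_0$, outside an event of probability at most $\varepsilon$, $$c\,|\log\Delta|\,r(n)\le N_\Delta\le C\,|\log\Delta|\,r(n)\qquad\text{for all }\Delta\in(0,\Delta_0].$$ **Theorem.** 1. If $f(1-x)\to c$ as $x\to0^+$ for some $c>0$ (for example, if $f$ is the uniform density, or $f(1-x)=c+O(x^\delta)$ with $\delta>0$), then $N_\Delta=|\log\Delta|\,\Theta(n)$. 2. If $f(1-x)\sim c\,x^\beta$ as $x\to0^+$ for some $c>0$ and $\beta>0$ (for example, if $f(1-x)=c\,x^\beta+O(x^{\beta+\delta})$ with $\delta>0$), then $N_\Delta=|\log\Delta|\,\Theta(n^{1/(1+\beta)})$. 3. If $f(1-x)\sim c\,x^\beta$ as $x\to0^+$ for some $c>0$ and $-1<\beta<0$, then $N_\Delta=|\log\Delta|\,\Theta(n^{1/(1+\beta)})$. -/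

import Mathlib

open MeasureTheory ProbabilityTheory Filter Topology Asymptotics Set

universe u v

/-- The words that refer to the concept `R₀`, as a probability space, together with the list of
those concepts among `R₀, …, Rₙ` to which each word refers. -/
structure WordModel (n : ℕ) where
  /-- the words referring to `R₀` -/
  Word : Type v
  /-- the events -/
  mWord : MeasurableSpace Word
  /-- the law of a word produced by the teacher -/
  prob : Measure Word
  isProb : IsProbabilityMeasure prob
  /-- the concepts to which a word refers -/
  concepts : Word → Set (Fin (n + 1))
  measurableSet_refers : ∀ i, MeasurableSet {w | i ∈ concepts w}
  zero_mem : ∀ w, 0 ∈ concepts w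

attribute [instance] WordModel.mWord WordModel.isProb

namespace WordModel

variable {n : ℕ} (M : WordModel.{v} n)

/-- The probability that a word refers to all the concepts `R_{i+1}`, `i ∈ s`. -/
noncomputable def jointOverlap (s : Finset (Fin n)) : ℝ :=
  M.prob.real {w | ∀ i ∈ s, i.succ ∈ M.concepts w}

/-- The overlap of the concept `R_{i+1}` with `R₀`. -/
noncomputable def overlap (i : Fin n) : ℝ :=
  M.prob.real {w | i.succ ∈ M.concepts w}

/-- The independence hypothesis: joint overlaps are products of overlaps. -/
def IndependentConcepts : Prop :=
  ∀ s : Finset (Fin n), M.jointOverlap s = ∏ i ∈ s, M.overlap i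

/-- After the words `w 0, …, w (k - 1)` the only concept common to all their lists is `R₀`. -/
def Learned {k : ℕ} (w : Fin k → M.Word) : Prop :=
  (⋂ j, M.concepts (w j)) = {0}

/-- The probability that the batch learner has learned `R₀` from `k` independent words. -/
noncomputable def learnProb (k : ℕ) : ℝ :=
  (Measure.pi fun _ : Fin k => M.prob).real {w | M.Learned w}

/-- The least number of steps after which the batch learner has learned `R₀` with probability at
least `1 - Δ`; it is `⊤` if there is no such number. -/
noncomputable def batchTime (Δ : ℝ) : ℕ∞ :=
  ⨅ (k : ℕ) (_ : 1 - Δ ≤ M.learnProb k), (k : ℕ∞)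

end WordModel

/-- `f` is a probability density on `[0, 1]`. -/
structure IsOverlapDensity (f : ℝ → ℝ) : Prop where
  measurable : Measurable f
  nonneg : ∀ x, 0 ≤ f x
  eq_zero : ∀ x, x ∉ Icc (0 : ℝ) 1 → f x = 0
  lintegral_eq_one : ∫⁻ x, ENNReal.ofReal (f x) = 1

/-- A random word model, whose overlaps are independent with common density `f`, and which
almost surely satisfies the independence hypothesis. -/
structure IsRandomOverlapModel (f : ℝ → ℝ) {n : ℕ} {Ω : Type u} [MeasurableSpace Ω]
    (P : Measure Ω) (M : Ω → WordModel.{v} n) : Prop where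
  hasLaw : ∀ i : Fin n, HasLaw (fun ω => (M ω).overlap i)
    (volume.withDensity fun x => ENNReal.ofReal (f x)) P
  iIndep : iIndepFun (fun (i : Fin n) ω => (M ω).overlap i) P
  independentConcepts : ∀ᵐ ω ∂P, (M ω).IndependentConcepts

/-- `N_Δ = |log Δ| Θ(r n)`. Almost surely every `N_Δ` is finite, and `N_Δ / (|log Δ| r n)` lies
between two positive constants for all large `n`, outside an event of probability at most `ε`.
The constants depend only on the density `f`, on `ε` and on an upper bound `Δ₀ < 1` of `Δ`; the
exceptional event is the same for all `Δ ∈ (0, Δ₀]`. -/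
def BatchTimeIsTheta (f : ℝ → ℝ) (r : ℕ → ℝ) : Prop :=
  (∀ (n : ℕ) (Ω : Type u) [MeasurableSpace Ω] (P : Measure Ω) [IsProbabilityMeasure P]
      (M : Ω → WordModel.{v} n), IsRandomOverlapModel f P M →
      ∀ᵐ ω ∂P, ∀ Δ ∈ Ioo (0 : ℝ) 1, (M ω).batchTime Δ ≠ ⊤) ∧
  ∀ Δ₀ ∈ Ioo (0 : ℝ) 1, ∀ ε : ℝ, 0 < ε → ∃ c C : ℝ, 0 < c ∧ 0 < C ∧ ∃ n₀ : ℕ, ∀ n ≥ n₀,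
    ∀ (Ω : Type u) [MeasurableSpace Ω] (P : Measure Ω) [IsProbabilityMeasure P]
      (M : Ω → WordModel.{v} n), IsRandomOverlapModel f P M →
      P {ω | ¬ ∀ Δ ∈ Ioc (0 : ℝ) Δ₀, ∃ N : ℕ, (M ω).batchTime Δ = N ∧
        c * (|Real.log Δ| * r n) ≤ N ∧ N ≤ C * (|Real.log Δ| * r n)} ≤ ENNReal.ofReal ε

/-! For fixed overlaps, independence gives `learnProb k = ∏ (1 - p_i ^ k)`, which lies between `1 -
∑ p_i ^ k` and `1 - p_i ^ k` for each `i`. Hence a small power sum bounds the time above, and a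
single overlap near `1` bounds it below (`exists_batchTime_bounds`). Put `r = n ^ (1 / (1 + β))`.
The density behaves like `(1 - x) ^ β` near `1`, so its `k`-th moment is `O(k ^ (-(β + 1)))`. With
`k ≈ B r` the expected power sum is `O(B ^ (-(β + 1)))`, and Markov's inequality gives the upper
bound. Mass of order `x ^ (β + 1)` lies in `[1 - x, 1]`, so with `x = a / r` some overlap reaches it
except with probability `exp (-q a ^ (β + 1))`; this gives the lower bound. Both events involve `Δ₀`
but not `Δ`. The three cases differ only in `β`, with `β = 0` in the first. -/

namespace WordModel

variable {n : ℕ} (M : WordModel.{v} n)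

/-! ### Learning probability for fixed overlaps -/

lemma overlap_nonneg (i : Fin n) : 0 ≤ M.overlap i := measureReal_nonneg

lemma overlap_le_one (i : Fin n) : M.overlap i ≤ 1 := measureReal_le_one

/-- The event that `k` words all refer to the concept `R_{i+1}`. -/
def survives (k : ℕ) (i : Fin n) : Set (Fin k → M.Word) :=
  {w | ∀ j, i.succ ∈ M.concepts (w j)}

lemma setOf_learned_eq (k : ℕ) :
    {w : Fin k → M.Word | M.Learned w} = ⋂ i, (M.survives k i)ᶜ := by
  ext w
  simp only [mem_ofPred_eq, Learned, survives, mem_iInter, mem_compl_iff]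
  constructor
  · intro h i hi
    have : i.succ ∈ ⋂ j, M.concepts (w j) := mem_iInter.2 hi
    rw [h] at this
    exact Fin.succ_ne_zero i this
  · intro h
    ext i
    simp only [mem_iInter, mem_singleton_iff]
    refine ⟨fun hi => ?_, fun hi j => hi ▸ M.zero_mem _⟩
    by_contra h0
    obtain ⟨i, rfl⟩ := Fin.exists_succ_eq.2 h0
    exact h i hi

lemma measure_biInter_survives (k : ℕ) (s : Finset (Fin n)) :
    (Measure.pi fun _ : Fin k => M.prob) (⋂ i ∈ s, M.survives k i)
      = ENNReal.ofReal (M.jointOverlap s) ^ k := by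
  have : (⋂ i ∈ s, M.survives k i)
      = Set.pi univ fun _ : Fin k => {w | ∀ i ∈ s, i.succ ∈ M.concepts w} := by
    ext w
    simp only [survives, mem_iInter, mem_ofPred_eq, mem_univ_pi]
    exact ⟨fun h j i hi => h i hi j, fun h i hi j => h j i hi⟩
  rw [this, Measure.pi_pi, Finset.prod_const, Finset.card_univ, Fintype.card_fin, jointOverlap,
    ofReal_measureReal]

lemma jointOverlap_singleton (i : Fin n) : M.jointOverlap {i} = M.overlap i := by
  simp [jointOverlap, overlap]

lemma measure_survives (k : ℕ) (i : Fin n) :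
    (Measure.pi fun _ : Fin k => M.prob) (M.survives k i) = ENNReal.ofReal (M.overlap i) ^ k := by
  simpa [jointOverlap_singleton] using M.measure_biInter_survives k {i}

lemma measurableSet_survives (k : ℕ) (i : Fin n) : MeasurableSet (M.survives k i) := by
  rw [survives, ofPred_forall]
  exact MeasurableSet.iInter fun j => 
    measurableSet_preimage (by fun_prop : Measurable fun w : Fin k → M.Word => w j)
      (M.measurableSet_refers i.succ)

variable {M}

/-- The product rule for joint overlaps, raised to the power `k`, says exactly that the survival
events are independent; so are their complements, whose intersection is the learning event. -/
lemma IndependentConcepts.learnProb_eq (h : M.IndependentConcepts) (k : ℕ) :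
    M.learnProb k = ∏ i, (1 - M.overlap i ^ k) := by
  have hind : iIndepSet (M.survives k) (Measure.pi fun _ : Fin k => M.prob) := by
    rw [iIndepSet_iff_meas_biInter (M.measurableSet_survives k)]
    intro s
    simp_rw [measure_biInter_survives, measure_survives]
    rw [h s, ENNReal.ofReal_prod_of_nonneg fun i _ => M.overlap_nonneg i, Finset.prod_pow]
  rw [iIndepSet_iff_iIndep] at hind
  have hm := hind.meas_iInter (s := fun i => (M.survives k i)ᶜ) fun i =>
    (MeasurableSpace.measurableSet_generateFrom (mem_singleton _)).compl
  rw [learnProb, setOf_learned_eq, Measure.real, hm, ENNReal.toReal_prod]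
  refine Finset.prod_congr rfl fun i _ => ?_
  rw [← Measure.real, probReal_compl_eq_one_sub (M.measurableSet_survives k i), Measure.real,
    measure_survives, ENNReal.toReal_pow, ENNReal.toReal_ofReal (M.overlap_nonneg i)]

lemma exists_batchTime_eq {Δ : ℝ} {k : ℕ} (hk : 1 - Δ ≤ M.learnProb k) :
    ∃ N : ℕ, M.batchTime Δ = N ∧ 1 - Δ ≤ M.learnProb N ∧ N ≤ k := by
  classical
  have hex : ∃ k, 1 - Δ ≤ M.learnProb k := ⟨k, hk⟩
  refine ⟨Nat.find hex, le_antisymm (iInf₂_le (Nat.find hex) (Nat.find_spec hex)) ?_,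
    Nat.find_spec hex, Nat.find_min' hex hk⟩
  exact le_iInf₂ fun j hj => by exact_mod_cast Nat.find_min' hex hj

lemma IndependentConcepts.one_sub_sum_le_learnProb (h : M.IndependentConcepts) (k : ℕ) :
    1 - ∑ i, M.overlap i ^ k ≤ M.learnProb k := by
  rw [h.learnProb_eq]
  have h0 : ∀ i, 0 ≤ M.overlap i ^ k := fun i => pow_nonneg (M.overlap_nonneg i) k
  have h1 : ∀ i, M.overlap i ^ k ≤ 1 := fun i => pow_le_one₀ (M.overlap_nonneg i)
    (M.overlap_le_one i)
  induction (Finset.univ : Finset (Fin n)) using Finset.induction_on with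
  | empty => simp
  | insert i s hi ih =>
    rw [Finset.sum_insert hi, Finset.prod_insert hi]
    have hle : ∏ j ∈ s, (1 - M.overlap j ^ k) ≤ 1 :=
      Finset.prod_le_one (fun j _ => sub_nonneg.2 (h1 j)) fun j _ => by linarith [h0 j]
    nlinarith [h0 i, h1 i]

lemma IndependentConcepts.learnProb_le (h : M.IndependentConcepts) (k : ℕ) (i : Fin n) :
    M.learnProb k ≤ 1 - M.overlap i ^ k := by
  have h1 : ∀ j, 0 ≤ 1 - M.overlap j ^ k := fun j =>
    sub_nonneg.2 (pow_le_one₀ (M.overlap_nonneg j) (M.overlap_le_one j))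
  rw [h.learnProb_eq, ← Finset.mul_prod_erase _ _ (Finset.mem_univ i)]
  refine mul_le_of_le_one_right (h1 i) (Finset.prod_le_one (fun j _ => h1 j) fun j _ => ?_)
  linarith [pow_nonneg (M.overlap_nonneg j) k]

lemma IndependentConcepts.batchTime_ne_top (h : M.IndependentConcepts)
    (hlt : ∀ i, M.overlap i < 1) {Δ : ℝ} (hΔ : 0 < Δ) : M.batchTime Δ ≠ ⊤ := by
  have ht : Tendsto (fun k => ∑ i, M.overlap i ^ k) atTop (𝓝 0) := by
    simpa using tendsto_finsetSum Finset.univ fun i _ =>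
      tendsto_pow_atTop_nhds_zero_of_lt_one (M.overlap_nonneg i) (hlt i)
  obtain ⟨k, hk⟩ := (ht.eventually_le_const hΔ).exists
  obtain ⟨N, hN, -⟩ := exists_batchTime_eq (M := M) (Δ := Δ) (k := k)
    (by linarith [h.one_sub_sum_le_learnProb k])
  simp [hN]

end WordModel

/-! ### Time bounds for fixed overlaps, uniform in `Δ` -/

/-- Each term is at most the whole sum. This turns a bound `Δ₀` at time `k` into `Δ₀ ^ m` at time `k
* m`, so one event serves every `Δ ≤ Δ₀`. -/
lemma Finset.sum_pow_mul_le {ι : Type*} (s : Finset ι) {p : ι → ℝ} (hp : ∀ i, 0 ≤ p i)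
    (k : ℕ) {m : ℕ} (hm : m ≠ 0) : ∑ i ∈ s, p i ^ (k * m) ≤ (∑ i ∈ s, p i ^ k) ^ m := by
  obtain ⟨m, rfl⟩ := Nat.exists_eq_succ_of_ne_zero hm
  rw [pow_succ, Finset.mul_sum]
  refine Finset.sum_le_sum fun i hi => ?_
  rw [pow_mul, pow_succ]
  have h0 : ∀ i, 0 ≤ p i ^ k := fun i => pow_nonneg (hp i) k
  exact mul_le_mul_of_nonneg_right (pow_le_pow_left₀ (h0 i)
    (Finset.single_le_sum (f := fun i => p i ^ k) (fun j _ => h0 j) hi) m) (h0 i)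

lemma abs_log_le_mul_of_pow_le {x p Δ : ℝ} {N : ℕ} (hx : x ≤ 1 / 2) (hp : 1 - x ≤ p)
    (hp1 : p ≤ 1) (hΔ : 0 < Δ) (hΔ1 : Δ ≤ 1) (h : p ^ N ≤ Δ) : |Real.log Δ| ≤ N * (2 * x) := by
  have hp0 : 0 < p := by linarith
  rw [abs_of_nonpos (Real.log_nonpos hΔ.le hΔ1)]
  have h1 : N * Real.log p ≤ Real.log Δ := by
    rw [← Real.log_pow]; exact Real.log_le_log (pow_pos hp0 N) h
  have h2 : -(2 * x) ≤ Real.log p := by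
    refine le_trans ?_ (Real.one_sub_inv_le_log_of_pos hp0)
    have : p⁻¹ ≤ 1 + 2 * x := by
      rw [inv_le_iff_one_le_mul₀ hp0]
      nlinarith
    linarith
  have h3 := mul_le_mul_of_nonneg_left h2 (Nat.cast_nonneg (α := ℝ) N)
  linarith

lemma WordModel.IndependentConcepts.exists_batchTime_bounds {n : ℕ} {M : WordModel.{v} n}
    (h : M.IndependentConcepts) {Δ₀ : ℝ} (h0 : 0 < Δ₀) (h1 : Δ₀ < 1) {k : ℕ}
    (hk : ∑ i, M.overlap i ^ k ≤ Δ₀) {x : ℝ} (hx : x ≤ 1 / 2) {i : Fin n}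
    (hi : 1 - x ≤ M.overlap i) {Δ : ℝ} (hΔ : Δ ∈ Ioc 0 Δ₀) :
    ∃ N : ℕ, M.batchTime Δ = N ∧ |Real.log Δ| ≤ N * (2 * x) ∧
      N ≤ k * (2 * (|Real.log Δ| / |Real.log Δ₀|)) := by
  have hlog : 0 < |Real.log Δ₀| := abs_pos.2 (Real.log_neg h0 h1).ne
  have hΔ1 : Δ < 1 := hΔ.2.trans_lt h1
  have hle : |Real.log Δ₀| ≤ |Real.log Δ| := by
    rw [abs_of_neg (Real.log_neg h0 h1), abs_of_neg (Real.log_neg hΔ.1 hΔ1)]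
    exact neg_le_neg (Real.log_le_log hΔ.1 hΔ.2)
  set y := |Real.log Δ| / |Real.log Δ₀| with hy
  -- `1 ≤ y` makes the number of repetitions nonzero and later gives `⌈y⌉₊ ≤ 2 * y`.
  have hy1 : 1 ≤ y := (one_le_div hlog).2 hle
  have hceil : ⌈y⌉₊ ≠ 0 := (Nat.ceil_pos.2 (by linarith)).ne'
  have hpow : Δ₀ ^ ⌈y⌉₊ ≤ Δ := by
    rw [← Real.log_le_log_iff (pow_pos h0 _) hΔ.1, Real.log_pow]
    have := mul_le_mul_of_nonneg_right (Nat.le_ceil y) hlog.le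
    rw [hy, div_mul_cancel₀ _ hlog.ne', ← hy, abs_of_neg (Real.log_neg h0 h1),
      abs_of_neg (Real.log_neg hΔ.1 hΔ1)] at this
    linarith
  have hsum : ∑ i, M.overlap i ^ (k * ⌈y⌉₊) ≤ Δ :=
    (Finset.sum_pow_mul_le _ M.overlap_nonneg k hceil).trans <| (pow_le_pow_left₀
      (Finset.sum_nonneg fun i _ => pow_nonneg (M.overlap_nonneg i) k) hk _).trans hpow
  obtain ⟨N, hN, hNle, hNk⟩ := WordModel.exists_batchTime_eq (M := M) (Δ := Δ) (k := k * ⌈y⌉₊)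
    (by linarith [h.one_sub_sum_le_learnProb (k * ⌈y⌉₊)])
  refine ⟨N, hN, abs_log_le_mul_of_pow_le hx hi (M.overlap_le_one i) hΔ.1 hΔ1.le
    (by linarith [h.learnProb_le N i]), ?_⟩
  calc (N : ℝ) ≤ (k : ℝ) * ⌈y⌉₊ := by exact_mod_cast hNk
    _ ≤ k * (2 * y) := by
      gcongr
      linarith [Nat.ceil_lt_add_one (show 0 ≤ y by linarith)]

/-! ### Moments and mass of the density near `1` -/

/-- The density near `1` is comparable with `c * (1 - x) ^ β`. -/
def HasEdgeExponent (f : ℝ → ℝ) (c β : ℝ) : Prop :=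
  ∀ᶠ t in 𝓝[>] (0 : ℝ), c / 2 * t ^ β ≤ f (1 - t) ∧ f (1 - t) ≤ 2 * c * t ^ β

lemma HasEdgeExponent.of_tendsto {f : ℝ → ℝ} {c : ℝ} (hc : 0 < c)
    (h : Tendsto (fun x => f (1 - x)) (𝓝[>] 0) (𝓝 c)) : HasEdgeExponent f c 0 := by
  filter_upwards [h.eventually_const_le (show c / 2 < c by linarith),
    h.eventually_le_const (show c < 2 * c by linarith)] with t h1 h2
  simpa using ⟨h1, h2⟩

lemma HasEdgeExponent.of_isEquivalent {f : ℝ → ℝ} {c β : ℝ} (hc : 0 < c)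
    (h : (fun x => f (1 - x)) ~[𝓝[>] 0] (fun x : ℝ => c * x ^ β)) : HasEdgeExponent f c β := by
  obtain ⟨φ, hφ, hf⟩ := h.exists_eq_mul
  filter_upwards [hf, hφ.eventually_const_le (show (1 / 2 : ℝ) < 1 by norm_num),
    hφ.eventually_le_const (show (1 : ℝ) < 2 by norm_num), self_mem_nhdsWithin] with t h1 h2 h3 ht
  have : 0 ≤ c * t ^ β := mul_nonneg hc.le (Real.rpow_nonneg (le_of_lt ht) β)
  simp only [h1, Pi.mul_apply]
  constructor <;> nlinarith

lemma HasEdgeExponent.exists_forall {f : ℝ → ℝ} {c β : ℝ} (h : HasEdgeExponent f c β) :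
    ∃ δ, 0 < δ ∧ δ < 1 ∧ ∀ t, 0 < t → t < δ →
      c / 2 * t ^ β ≤ f (1 - t) ∧ f (1 - t) ≤ 2 * c * t ^ β := by
  obtain ⟨δ, hδ, hsub⟩ := (mem_nhdsGT_iff_exists_Ioo_subset).1 h
  exact ⟨min δ (1 / 2), lt_min hδ (by norm_num), (min_le_right _ _).trans_lt (by norm_num),
    fun t h0 h1 => hsub ⟨h0, h1.trans_le (min_le_left _ _)⟩⟩

lemma lintegral_rpow_mul_exp_neg_mul_Ioi {a r : ℝ} (ha : 0 < a) (hr : 0 < r) :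
    ∫⁻ t in Ioi 0, ENNReal.ofReal (t ^ (a - 1) * Real.exp (-(r * t)))
      = ENNReal.ofReal ((1 / r) ^ a * Real.Gamma a) := by
  have hpos : 0 < (1 / r) ^ a * Real.Gamma a :=
    mul_pos (Real.rpow_pos_of_pos (one_div_pos.2 hr) _) (Real.Gamma_pos_of_pos ha)
  rw [← Real.integral_rpow_mul_exp_neg_mul_Ioi ha hr] at hpos ⊢
  -- Integrability comes for free: a nonintegrable function would have integral `0`, but this one is
  -- positive.
  rw [ofReal_integral_eq_lintegral_ofReal (not_imp_comm.1 integral_undef hpos.ne')]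
  filter_upwards [ae_restrict_mem measurableSet_Ioi] with t ht
  exact mul_nonneg (Real.rpow_nonneg (le_of_lt ht) _) (Real.exp_nonneg _)

/-- The law with density `f`. -/
noncomputable abbrev overlapLaw (f : ℝ → ℝ) : Measure ℝ :=
  volume.withDensity fun x => ENNReal.ofReal (f x)

lemma IsOverlapDensity.isProbabilityMeasure {f : ℝ → ℝ} (hf : IsOverlapDensity f) :
    IsProbabilityMeasure (overlapLaw f) :=
  ⟨by rw [withDensity_apply _ MeasurableSet.univ, Measure.restrict_univ, hf.lintegral_eq_one]⟩

/-- Split at `1 - δ`: below it `x ^ k ≤ (1 - δ) ^ k`; above it `x ^ k ≤ exp (-k (1 - x))` reduces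
the moment to a Gamma integral. -/
lemma IsOverlapDensity.lintegral_pow_le {f : ℝ → ℝ} (hf : IsOverlapDensity f) {c β δ : ℝ}
    (hc : 0 < c) (hβ : -1 < β) (hδ1 : δ < 1)
    (h : ∀ t, 0 < t → t < δ → f (1 - t) ≤ 2 * c * t ^ β) {k : ℕ} (hk : 0 < k) :
    ∫⁻ x, ENNReal.ofReal (x ^ k) ∂overlapLaw f
      ≤ ENNReal.ofReal ((1 - δ) ^ k + 2 * c * ((1 / k : ℝ) ^ (β + 1) * Real.Gamma (β + 1))) := by
  have hm : Measurable fun x => ENNReal.ofReal (f x) := hf.measurable.ennreal_ofReal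
  have hk0 : (0 : ℝ) < k := Nat.cast_pos.2 hk
  set g : ℝ → ENNReal :=
    (Ioi 0).indicator fun t => ENNReal.ofReal (t ^ β * Real.exp (-(k * t))) with hg
  have hgm : Measurable g := Measurable.indicator (by fun_prop) measurableSet_Ioi
  have hgi : ∫⁻ x, g (1 - x) = ENNReal.ofReal ((1 / k : ℝ) ^ (β + 1) * Real.Gamma (β + 1)) := by
    rw [lintegral_sub_left_eq_self g 1, hg, lintegral_indicator measurableSet_Ioi]
    simpa using lintegral_rpow_mul_exp_neg_mul_Ioi (a := β + 1) (by linarith) hk0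
  rw [lintegral_withDensity_eq_lintegral_mul _ hm (by fun_prop)]
  calc ∫⁻ x, ((fun x => ENNReal.ofReal (f x)) * fun x => ENNReal.ofReal (x ^ k)) x
      ≤ ∫⁻ x, (ENNReal.ofReal ((1 - δ) ^ k) * ENNReal.ofReal (f x)
          + ENNReal.ofReal (2 * c) * g (1 - x)) := by
        refine lintegral_mono_ae ?_
        filter_upwards [Measure.ae_ne volume (1 : ℝ)] with x hx1
        simp only [Pi.mul_apply]
        by_cases hx : x ∈ Icc (0 : ℝ) 1
        · by_cases hxδ : x ≤ 1 - δ
          · refine le_add_right ?_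
            rw [mul_comm]
            gcongr
            exact hx.1
          · refine le_add_left ?_
            have ht : 0 < 1 - x := sub_pos.2 (lt_of_le_of_ne hx.2 hx1)
            rw [hg, indicator_of_mem (mem_Ioi.2 ht), ← ENNReal.ofReal_mul (hf.nonneg x),
              ← ENNReal.ofReal_mul (by linarith)]
            refine ENNReal.ofReal_le_ofReal ?_
            have h1 := h (1 - x) ht (by linarith)
            rw [sub_sub_cancel] at h1
            have h2 : x ^ k ≤ Real.exp (-(k * (1 - x))) := by
              rw [← mul_neg, Real.exp_nat_mul]
              exact pow_le_pow_left₀ hx.1 (by linarith [Real.add_one_le_exp (-(1 - x))]) k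
            rw [← mul_assoc]
            exact mul_le_mul h1 h2 (pow_nonneg hx.1 k) ((hf.nonneg x).trans h1)
        · simp [hf.eq_zero x hx]
    _ = _ := by
        rw [lintegral_add_left (by fun_prop), lintegral_const_mul _ hm,
          lintegral_const_mul _ (by fun_prop), hf.lintegral_eq_one, hgi, mul_one,
          ← ENNReal.ofReal_mul (by linarith), ← ENNReal.ofReal_add]
        · exact pow_nonneg (by linarith) k
        · have := Real.Gamma_pos_of_pos (show 0 < β + 1 by linarith)
          positivity

lemma IsOverlapDensity.exists_lintegral_pow_le {f : ℝ → ℝ} (hf : IsOverlapDensity f) {c β : ℝ}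
    (hc : 0 < c) (hβ : -1 < β) (h : HasEdgeExponent f c β) :
    ∃ A : ℝ, 0 < A ∧ ∃ K : ℕ, ∀ k ≥ K,
      ∫⁻ x, ENNReal.ofReal (x ^ k) ∂overlapLaw f ≤ ENNReal.ofReal (A * (k : ℝ) ^ (-(β + 1))) := by
  obtain ⟨δ, hδ, hδ1, hb⟩ := h.exists_forall
  have hΓ := Real.Gamma_pos_of_pos (show 0 < β + 1 by linarith)
  have ht := (tendsto_rpow_mul_exp_neg_mul_atTop_nhds_zero (β + 1) δ hδ).comp
    (tendsto_natCast_atTop_atTop (R := ℝ))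
  obtain ⟨K, hK⟩ := eventually_atTop.1
    ((ht.eventually_le_const zero_lt_one).and (eventually_gt_atTop 0))
  -- The summand `1` absorbs `(1 - δ) ^ k`, which is eventually below `k ^ (-(β + 1))`.
  refine ⟨1 + 2 * c * Real.Gamma (β + 1), by positivity, K, fun k hk => ?_⟩
  obtain ⟨hk1, hk0⟩ := hK k hk
  have hk0' : (0 : ℝ) < k := Nat.cast_pos.2 hk0
  refine (hf.lintegral_pow_le hc hβ hδ1 (fun t h0 h1 => (hb t h0 h1).2) hk0).trans
    (ENNReal.ofReal_le_ofReal ?_)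
  have h1 : (1 - δ) ^ k ≤ Real.exp (-δ * k) := by
    rw [mul_comm, Real.exp_nat_mul]
    exact pow_le_pow_left₀ (by linarith) (by linarith [Real.add_one_le_exp (-δ)]) k
  have h2 : Real.exp (-δ * k) ≤ (k : ℝ) ^ (-(β + 1)) := by
    rw [Real.rpow_neg hk0'.le, ← one_div, le_div_iff₀ (Real.rpow_pos_of_pos hk0' _), mul_comm]
    exact hk1
  rw [one_div, Real.inv_rpow hk0'.le, ← Real.rpow_neg hk0'.le]
  linarith

lemma HasEdgeExponent.exists_le_overlapLaw_Ici {f : ℝ → ℝ} {c β : ℝ}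
    (hc : 0 < c) (hβ : -1 < β) (h : HasEdgeExponent f c β) :
    ∃ q δ : ℝ, 0 < q ∧ 0 < δ ∧ ∀ x, 0 < x → x < δ →
      ENNReal.ofReal (q * x ^ (β + 1)) ≤ overlapLaw f (Ici (1 - x)) := by
  obtain ⟨δ, hδ, -, hb⟩ := h.exists_forall
  have hβ' : 0 < β + 1 := by linarith
  refine ⟨c / 2 / (β + 1), δ, by positivity, hδ, fun x hx hxδ => ?_⟩
  have hint : ∫ t in Ioc 0 x, c / 2 * t ^ β = c / 2 / (β + 1) * x ^ (β + 1) := by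
    rw [← intervalIntegral.integral_of_le hx.le, intervalIntegral.integral_const_mul,
      integral_rpow (Or.inl hβ), Real.zero_rpow hβ'.ne']
    ring
  have hii : IntegrableOn (fun t : ℝ => c / 2 * t ^ β) (Ioc 0 x) :=
    (intervalIntegrable_iff_integrableOn_Ioc_of_le hx.le).1
      ((intervalIntegral.intervalIntegrable_rpow' hβ).const_mul _)
  rw [withDensity_apply _ measurableSet_Ici, ← lintegral_indicator measurableSet_Ici,
    ← lintegral_sub_left_eq_self _ (1 : ℝ), ← hint, ofReal_integral_eq_lintegral_ofReal hii,
    ← lintegral_indicator measurableSet_Ioc]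
  · refine lintegral_mono fun t => ?_
    by_cases ht : t ∈ Ioc 0 x
    · rw [indicator_of_mem ht, indicator_of_mem (mem_Ici.2 (by linarith [ht.2]))]
      exact ENNReal.ofReal_le_ofReal (hb t ht.1 (ht.2.trans_lt hxδ)).1
    · simp [indicator_of_notMem ht]
  · filter_upwards [ae_restrict_mem measurableSet_Ioc] with t ht
    have := Real.rpow_nonneg ht.1.le β
    positivity

/-! ### Random overlaps: power sums and the maximum -/

section RandomModel

variable {f : ℝ → ℝ} {n : ℕ} {Ω : Type u} [MeasurableSpace Ω] {P : Measure Ω}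
  {M : Ω → WordModel.{v} n}

lemma IsRandomOverlapModel.ae_overlap_lt_one (hM : IsRandomOverlapModel f P M) :
    ∀ᵐ ω ∂P, ∀ i, (M ω).overlap i < 1 := by
  refine ae_all_iff.2 fun i => ?_
  have h1 : ∀ᵐ x ∂overlapLaw f, x ≠ 1 :=
    (withDensity_absolutelyContinuous _ _).ae_le (Measure.ae_ne volume (1 : ℝ))
  rw [overlapLaw, ← (hM.hasLaw i).map_eq] at h1
  filter_upwards [ae_of_ae_map (hM.hasLaw i).aemeasurable h1] with ω hω
  exact lt_of_le_of_ne ((M ω).overlap_le_one i) hω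

/-- Markov's inequality; only the common law matters here, not independence. -/
lemma IsRandomOverlapModel.mul_measure_sum_pow_ge_le (hM : IsRandomOverlapModel f P M) (k : ℕ)
    (a : ℝ) : ENNReal.ofReal a * P {ω | a ≤ ∑ i, (M ω).overlap i ^ k}
      ≤ n * ∫⁻ x, ENNReal.ofReal (x ^ k) ∂overlapLaw f := by
  have hae : ∀ i, AEMeasurable (fun ω => ENNReal.ofReal ((M ω).overlap i ^ k)) P := fun i =>
    ((hM.hasLaw i).aemeasurable.pow_const k).ennreal_ofReal
  calc ENNReal.ofReal a * P {ω | a ≤ ∑ i, (M ω).overlap i ^ k}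
      ≤ ENNReal.ofReal a *
          P {ω | ENNReal.ofReal a ≤ ∑ i, ENNReal.ofReal ((M ω).overlap i ^ k)} := by
        gcongr with ω
        intro hω
        rw [← ENNReal.ofReal_sum_of_nonneg fun i _ => pow_nonneg ((M ω).overlap_nonneg i) k]
        exact ENNReal.ofReal_le_ofReal hω
    _ ≤ ∫⁻ ω, ∑ i, ENNReal.ofReal ((M ω).overlap i ^ k) ∂P :=
        mul_meas_ge_le_lintegral₀ (Finset.aemeasurable_fun_sum _ fun i _ => hae i) _
    _ = ∑ i : Fin n, ∫⁻ x, ENNReal.ofReal (x ^ k) ∂overlapLaw f := by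
        rw [lintegral_finsetSum' _ fun i _ => hae i]
        exact Finset.sum_congr rfl fun i _ =>
          (hM.hasLaw i).lintegral_comp (f := fun x => ENNReal.ofReal (x ^ k)) (by fun_prop)
    _ = _ := by simp

lemma IsRandomOverlapModel.measure_forall_overlap_lt (hM : IsRandomOverlapModel f P M) (y : ℝ) :
    P {ω | ∀ i, (M ω).overlap i < y} = overlapLaw f (Iio y) ^ n := by
  have h := hM.iIndep.measure_inter_preimage_eq_mul Finset.univ (sets := fun _ => Iio y)
    fun _ _ => measurableSet_Iio
  have h2 : ∀ i, P ((fun ω => (M ω).overlap i) ⁻¹' Iio y) = overlapLaw f (Iio y) := fun i => by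
    rw [overlapLaw, ← (hM.hasLaw i).map_eq,
      Measure.map_apply_of_aemeasurable (hM.hasLaw i).aemeasurable measurableSet_Iio]
  simp_rw [h2, Finset.prod_const, Finset.card_univ, Fintype.card_fin] at h
  rw [← h]
  congr 1
  ext ω
  simp

lemma IsRandomOverlapModel.measure_forall_overlap_lt_le (hf : IsOverlapDensity f)
    (hM : IsRandomOverlapModel f P M) {x z : ℝ}
    (h : ENNReal.ofReal z ≤ overlapLaw f (Ici (1 - x))) :
    P {ω | ∀ i, (M ω).overlap i < 1 - x} ≤ ENNReal.ofReal (Real.exp (-(n * z))) := by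
  have := hf.isProbabilityMeasure
  rw [hM.measure_forall_overlap_lt, ← mul_neg, Real.exp_nat_mul,
    ENNReal.ofReal_pow (Real.exp_nonneg _)]
  gcongr
  rw [← compl_Ici, prob_compl_eq_one_sub measurableSet_Ici, ← ENNReal.ofReal_one]
  refine (tsub_le_tsub_left h _).trans (tsub_le_iff_right.2 ?_)
  refine le_trans (ENNReal.ofReal_le_ofReal (show (1 : ℝ) ≤ Real.exp (-z) + z by
    linarith [Real.add_one_le_exp (-z)])) ENNReal.ofReal_add_le

end RandomModel

/-! ### Choice of constants and conclusion -/

theorem IsOverlapDensity.batchTimeIsTheta {f : ℝ → ℝ} (hf : IsOverlapDensity f) {c β : ℝ}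
    (hc : 0 < c) (hβ : -1 < β) (h : HasEdgeExponent f c β) :
    BatchTimeIsTheta.{u, v} f (fun n => (n : ℝ) ^ (1 / (1 + β))) := by
  refine ⟨fun n Ω _ P _ M hM => ?_, fun Δ₀ hΔ₀ ε hε => ?_⟩
  · filter_upwards [hM.ae_overlap_lt_one, hM.independentConcepts] with ω h1 h2 Δ hΔ
    exact h2.batchTime_ne_top h1 hΔ.1
  have hβ' : 0 < β + 1 := by linarith
  obtain ⟨A, hA, K, hK⟩ := hf.exists_lintegral_pow_le hc hβ h
  obtain ⟨q, δ, hq, hδ, hqδ⟩ := h.exists_le_overlapLaw_Ici hc hβ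
  have hlog : 0 < |Real.log Δ₀| := abs_pos.2 (Real.log_neg hΔ₀.1 hΔ₀.2).ne
  obtain ⟨B, hBε, hB⟩ : ∃ B : ℝ, A * B ^ (-(β + 1)) ≤ Δ₀ * (ε / 2) ∧ 0 < B := by
    have := (tendsto_rpow_neg_atTop hβ').const_mul A
    rw [mul_zero] at this
    exact ((this.eventually_le_const (show 0 < Δ₀ * (ε / 2) from
      mul_pos hΔ₀.1 (by linarith))).and (eventually_gt_atTop 0)).exists
  obtain ⟨a, haε, ha⟩ : ∃ a : ℝ, Real.exp (-(q * a ^ (β + 1))) ≤ ε / 2 ∧ 0 < a := by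
    have := Real.tendsto_exp_neg_atTop_nhds_zero.comp
      ((tendsto_rpow_atTop hβ').const_mul_atTop hq)
    exact ((this.eventually_le_const (show 0 < ε / 2 by linarith)).and
      (eventually_gt_atTop 0)).exists
  have hr : Tendsto (fun n : ℕ => (n : ℝ) ^ (1 / (1 + β))) atTop atTop :=
    (tendsto_rpow_atTop (by rw [add_comm]; positivity)).comp tendsto_natCast_atTop_atTop
  -- In order, these ensure `a / r < δ`, `a / r ≤ 1 / 2`, `⌈B * r⌉₊ ≤ 2 * B * r`, `K ≤ ⌈B * r⌉₊` and
  -- `n ≠ 0`.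
  obtain ⟨n₀, hn₀⟩ := eventually_atTop.1 <|
    (hr.eventually_gt_atTop (a / δ)).and <| (hr.eventually_ge_atTop (2 * a)).and <|
    (hr.eventually_ge_atTop (1 / B)).and <| (hr.eventually_ge_atTop (K / B)).and <|
    eventually_gt_atTop 0
  -- The lower constant inverts `|log Δ| ≤ N * (2 * a / r)`; the factor `4` collects two roundings
  -- up, of `B * r` and of `|log Δ| / |log Δ₀|`.
  refine ⟨1 / (2 * a), 4 * B / |Real.log Δ₀|, by positivity, by positivity, n₀,
    fun n hn Ω _ P _ M hM => ?_⟩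
  obtain ⟨h1, h2, h3, h4, hn0⟩ := hn₀ n hn
  have hn0' : (0 : ℝ) < n := Nat.cast_pos.2 hn0
  beta_reduce
  have hrpow : ((n : ℝ) ^ (1 / (1 + β))) ^ (β + 1) = n := by
    rw [← Real.rpow_mul hn0'.le, add_comm β, one_div_mul_cancel (by linarith), Real.rpow_one]
  set r := (n : ℝ) ^ (1 / (1 + β))
  have hr0 : 0 < r := Real.rpow_pos_of_pos hn0' _
  rw [div_lt_iff₀ hδ] at h1
  rw [div_le_iff₀ hB] at h3 h4
  have hk1 : B * r ≤ ⌈B * r⌉₊ := Nat.le_ceil _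
  have hk2 : (⌈B * r⌉₊ : ℝ) ≤ 2 * (B * r) := by
    linarith [Nat.ceil_lt_add_one (show 0 ≤ B * r by positivity)]
  have hkK : K ≤ ⌈B * r⌉₊ := by
    have : (K : ℝ) ≤ ⌈B * r⌉₊ := by linarith
    exact_mod_cast this
  set k := ⌈B * r⌉₊
  have hsum : P {ω | Δ₀ ≤ ∑ i, (M ω).overlap i ^ k} ≤ ENNReal.ofReal (ε / 2) := by
    have hle : (n : ENNReal) * ∫⁻ x, ENNReal.ofReal (x ^ k) ∂overlapLaw f
        ≤ ENNReal.ofReal Δ₀ * ENNReal.ofReal (ε / 2) := by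
      refine (mul_le_mul_right (hK k hkK) _).trans ?_
      rw [← ENNReal.ofReal_natCast, ← ENNReal.ofReal_mul hn0'.le, ← ENNReal.ofReal_mul hΔ₀.1.le]
      refine ENNReal.ofReal_le_ofReal (le_trans ?_ hBε)
      have : (k : ℝ) ^ (-(β + 1)) ≤ (B * r) ^ (-(β + 1)) :=
        Real.rpow_le_rpow_of_nonpos (by positivity) hk1 (by linarith)
      rw [Real.mul_rpow hB.le hr0.le, Real.rpow_neg hr0.le, hrpow] at this
      calc (n : ℝ) * (A * (k : ℝ) ^ (-(β + 1)))
          ≤ n * (A * (B ^ (-(β + 1)) * (n : ℝ)⁻¹)) := by gcongr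
        _ = A * B ^ (-(β + 1)) := by field_simp
    exact (ENNReal.mul_le_mul_iff_right (ENNReal.ofReal_pos.2 hΔ₀.1).ne' ENNReal.ofReal_ne_top).1
      ((hM.mul_measure_sum_pow_ge_le k Δ₀).trans hle)
  have hmax : P {ω | ∀ i, (M ω).overlap i < 1 - a / r} ≤ ENNReal.ofReal (ε / 2) := by
    refine (hM.measure_forall_overlap_lt_le hf (hqδ (a / r) (by positivity)
      ((div_lt_iff₀ hr0).2 (by linarith)))).trans (ENNReal.ofReal_le_ofReal (le_trans ?_ haε))
    rw [Real.div_rpow ha.le hr0.le, hrpow]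
    refine le_of_eq (congrArg Real.exp ?_)
    field_simp
  calc _ ≤ P ({ω | ¬ (M ω).IndependentConcepts} ∪ ({ω | Δ₀ ≤ ∑ i, (M ω).overlap i ^ k} ∪
        {ω | ∀ i, (M ω).overlap i < 1 - a / r})) := by
        refine measure_mono fun ω hω => ?_
        contrapose hω
        simp only [mem_union, mem_ofPred_eq, not_or, not_not, not_le, not_forall, not_lt] at hω
        rw [mem_ofPred_eq, not_not]
        obtain ⟨hi, hs, i, hmi⟩ := hω
        intro Δ hΔ
        obtain ⟨N, hN, hlo, hup⟩ := hi.exists_batchTime_bounds hΔ₀.1 hΔ₀.2 hs.le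
          ((div_le_iff₀ hr0).2 (by linarith)) hmi hΔ
        refine ⟨N, hN, ?_, hup.trans ?_⟩
        · calc 1 / (2 * a) * (|Real.log Δ| * r) ≤ 1 / (2 * a) * (N * (2 * (a / r)) * r) := by gcongr
            _ = N := by field_simp
        · calc k * (2 * (|Real.log Δ| / |Real.log Δ₀|))
              ≤ 2 * (B * r) * (2 * (|Real.log Δ| / |Real.log Δ₀|)) := by gcongr
            _ = _ := by ring
    _ ≤ 0 + (ENNReal.ofReal (ε / 2) + ENNReal.ofReal (ε / 2)) := by
        refine (measure_union_le _ _).trans (add_le_add (ae_iff.1 hM.independentConcepts).le ?_)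
        exact (measure_union_le _ _).trans (add_le_add hsum hmax)
    _ = ENNReal.ofReal ε := by
        rw [zero_add, ← ENNReal.ofReal_add (by linarith) (by linarith), add_halves]

theorem theoremA (f : ℝ → ℝ) (hf : IsOverlapDensity f) :
    (∀ c : ℝ, 0 < c → Tendsto (fun x => f (1 - x)) (𝓝[>] 0) (𝓝 c) →
      BatchTimeIsTheta.{u, v} f (fun n => (n : ℝ))) ∧
    (∀ c β : ℝ, 0 < c → 0 < β →
      (fun x => f (1 - x)) ~[𝓝[>] 0] (fun x : ℝ => c * x ^ β) →
      BatchTimeIsTheta.{u, v} f (fun n => (n : ℝ) ^ (1 / (1 + β)))) ∧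
    (∀ c β : ℝ, 0 < c → -1 < β → β < 0 →
      (fun x => f (1 - x)) ~[𝓝[>] 0] (fun x : ℝ => c * x ^ β) →
      BatchTimeIsTheta.{u, v} f (fun n => (n : ℝ) ^ (1 / (1 + β)))) := by
  refine ⟨fun c hc h => ?_, fun c β hc hβ h => ?_, fun c β hc hβ _ h => ?_⟩
  · simpa using hf.batchTimeIsTheta hc (by norm_num) (.of_tendsto hc h)
  · exact hf.batchTimeIsTheta hc (by linarith) (.of_isEquivalent hc h)
  · exact hf.batchTimeIsTheta hc hβ (.of_isEquivalent hc h)
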